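/- **Proposition 4.1.** Let $n\in C^1[0,1]$ be a positive real-valued function such that $n'$ is absolutely continuous with $n''\in L^2(0,1)$. Put $$\zeta(r)=\int_r^1\sqrt{n(t)}\,dt,\qquad \delta=\zeta(0),\qquad p(\zeta(r))=\frac{n''(r)}{4n(r)^2}-\frac{5n'(r)^2}{16n(r)^3},$$ and for $k\in\mathbb C$ let $\phi(k,\cdot)$ and $S(k,\cdot)$ be the solutions on $[0,\delta]$ of $-z''+p\,z=k^2z$ with $\phi(k,0)=1$, $\phi'(k,0)=0$ and $S(k,0)=0$, $S'(k,0)=1$. Let $$D_0(k)=a(k)\phi(k,\delta)+b(k)S(k,\delta),\qquad a(k)=n(1)^{1/4}\frac{\sin k}{k},\qquad b(k)=-\Big(\frac{\cos k}{n(1)^{1/4}}+\frac{n'(1)\sin k}{4n(1)^{5/4}k}\Big)$$ be the characteristic function of the special transmission eigenvalue problem. Let $g_n(\delta)$ and $s_n(\delta)$ be the coefficients of the Neumann series of spherical Bessel functions $$\phi(k,\delta)=\cos(k\delta)+\sum_{n=0}^\infty g_n(\delta)\,j_{2n}(k\delta),\qquad S(k,\delta)=\frac{\sin(k\delta)}{k}+\frac1k\sum_{n=0}^\infty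 s_n(\delta)\,j_{2n+1}(k\delta).$$ For $N\in\mathbb N$ let $\phi_N(k,\delta)$ and $S_N(k,\delta)$ be obtained by keeping only the terms with $n<N$, and let $D_{0,N}(k)=a(k)\phi_N(k,\delta)+b(k)S_N(k,\delta)$. (Quotients by $k$ are extended continuously to $k=0$.) Let $N\in\mathbb N$ and $\varepsilon,C\in\mathbb R$ be such that $$|D_0(k)-D_{0,N}(k)|<\varepsilon\quad\text{whenever } |\operatorname{Im}k|<C,$$ let $\gamma$ be a simple closed curve contained in the strip $|\operatorname{Im}k|<C$, and suppose that $\varepsilon<\min_{k\in\gamma}|D_{0,N}(k)|$. Then $D_0$ and $D_{0,N}$ are analytic inside $\gamma$ and have the same finite number of zeros inside $\gamma$, counted with multiplicity. This is also the number of zeros inside $\gamma$, counted with multiplicity, of $\frac{\sin k}{k}y'(k,1)-\cos(k)\,y(k,1)$, where $y(k,\cdot)$ solves $y''+k^2n(r)y=0$ on $[0,1]$ with $y(k,0)=0$, $y'(k,0)=1$. -/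

import Mathlib

open Set Filter Topology MeasureTheory

noncomputable section

/-! ### The refractive index and the Liouville transformation -/

/-- `n` is a positive function in `C¹[0,1]`, with derivative `n'`, and `n'` is absolutely
continuous on `[0,1]` with derivative `n'' ∈ L²(0,1)`. -/
structure IsRefractiveIndex (n n' n'' : ℝ → ℝ) : Prop where
  pos : ∀ r ∈ Icc (0 : ℝ) 1, 0 < n r
  hasDeriv : ∀ r ∈ Icc (0 : ℝ) 1, HasDerivWithinAt n (n' r) (Icc 0 1) r
  memLp : MemLp n'' 2 (volume.restrict (Ioo (0 : ℝ) 1))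
  deriv_eq : ∀ r ∈ Icc (0 : ℝ) 1, n' r = n' 0 + ∫ t in (0 : ℝ)..r, n'' t

/-- The Liouville variable `ζ(r) = ∫_r^1 √n(t) dt`. -/
def liouvilleZeta (n : ℝ → ℝ) (r : ℝ) : ℝ := ∫ t in r..(1 : ℝ), √(n t)

/-- The travel time `δ = ζ(0)`. -/
def travelTime (n : ℝ → ℝ) : ℝ := liouvilleZeta n 0

/-- The inverse `r = r(ζ)`, from `[0,δ]` to `[0,1]`, of the Liouville variable. -/
def liouvilleRadius (n : ℝ → ℝ) (x : ℝ) : ℝ :=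
  Function.invFunOn (liouvilleZeta n) (Icc 0 1) x

/-- The potential `p` on `(0,δ)`, given by
`p(ζ(r)) = n''(r) / (4 n(r)²) - 5 n'(r)² / (16 n(r)³)`. -/
def liouvillePotential (n n' n'' : ℝ → ℝ) (x : ℝ) : ℝ :=
  n'' (liouvilleRadius n x) / (4 * n (liouvilleRadius n x) ^ 2)
    - 5 * n' (liouvilleRadius n x) ^ 2 / (16 * n (liouvilleRadius n x) ^ 3)

/-! ### Solutions of initial value problems -/

/-- `u` is the solution on `[0,L]`, with derivative `u'`, of the initial value problem
`u'' = Q u`, `u(0) = c₀`, `u'(0) = c₁`, in the usual (Carathéodory) sense for integrable `Q`: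
`u` is continuously differentiable and `u'` is absolutely continuous with derivative `Q u`
almost everywhere. For continuous `Q` this is the classical notion. -/
structure IsIVPSolution (Q : ℝ → ℂ) (L : ℝ) (c₀ c₁ : ℂ) (u u' : ℝ → ℂ) : Prop where
  init : u 0 = c₀
  hasDeriv : ∀ x ∈ Icc 0 L, HasDerivWithinAt u (u' x) (Icc 0 L) x
  integrable : IntervalIntegrable (fun t => Q t * u t) volume 0 L
  deriv_eq : ∀ x ∈ Icc 0 L, u' x = c₁ + ∫ t in (0 : ℝ)..x, Q t * u t

/-! ### Spherical Bessel functions and Neumann series -/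

/-- The spherical Bessel function of the first kind
`j_n(z) = zⁿ ∑_m (-1)^m (z²/2)^m / (m! (2n+2m+1)!!)`. -/
def sphericalBesselJ (n : ℕ) (z : ℂ) : ℂ :=
  z ^ n * ∑' m : ℕ, (-1) ^ m * (z ^ 2 / 2) ^ m / ((m.factorial : ℂ) * ((2 * n + 2 * m + 1).doubleFactorial : ℂ))

/-- The coefficients `a_m` of the Neumann series `F(z) = ∑_m a_m j_m(z)` of an entire function
`F`. As `j_i` has a zero of order exactly `i` at the origin, they are determined recursively by
`F^{(m)}(0) = ∑_{i ≤ m} a_i j_i^{(m)}(0)`; see `neumannCoeff_eq` below. -/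
def neumannCoeff (F : ℂ → ℂ) (m : ℕ) : ℂ :=
  (iteratedDeriv m F 0
    - ∑ i : Fin m, neumannCoeff F i * iteratedDeriv m (sphericalBesselJ i) 0)
    / iteratedDeriv m (sphericalBesselJ m) 0
termination_by m
decreasing_by exact i.2

/-- The coefficients `g_n(x)` in `φ(ρ,x) = cos(ρx) + ∑_n g_n(x) j_{2n}(ρx)`; see `nsbfG_eq`. -/
def nsbfG (φ : ℂ → ℝ → ℂ) (x : ℝ) (n : ℕ) : ℂ :=
  neumannCoeff (fun z => φ (z / x) x - Complex.cos z) (2 * n)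

/-- The coefficients `s_n(x)` in `ρ S(ρ,x) = sin(ρx) + ∑_n s_n(x) j_{2n+1}(ρx)`;
see `nsbfS_eq`. -/
def nsbfS (S : ℂ → ℝ → ℂ) (x : ℝ) (n : ℕ) : ℂ :=
  neumannCoeff (fun z => z / x * S (z / x) x - Complex.sin z) (2 * n + 1)

/-- The quotient `f(k)/k`, for an entire `f` with `f(0) = 0`, with its removable singularity
at the origin removed. -/
def divVar (f : ℂ → ℂ) (k : ℂ) : ℂ := if k = 0 then deriv f 0 else f k / k

/-- The truncated series `φ_N(ρ,x) = cos(ρx) + ∑_{n<N} g_n(x) j_{2n}(ρx)`. -/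
def phiTrunc (φ : ℂ → ℝ → ℂ) (N : ℕ) (ρ : ℂ) (x : ℝ) : ℂ :=
  Complex.cos (ρ * x) + ∑ n ∈ Finset.range N, nsbfG φ x n * sphericalBesselJ (2 * n) (ρ * x)

/-- The truncated series `S_N(ρ,x) = sin(ρx)/ρ + (1/ρ) ∑_{n<N} s_n(x) j_{2n+1}(ρx)`. -/
def sTrunc (S : ℂ → ℝ → ℂ) (N : ℕ) (ρ : ℂ) (x : ℝ) : ℂ :=
  divVar (fun w => Complex.sin (w * x)) ρ
    + divVar (fun w => ∑ n ∈ Finset.range N,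
        nsbfS S x n * sphericalBesselJ (2 * n + 1) (w * x)) ρ

/-! ### Characteristic functions -/

/-- The characteristic function `(sin k / k) y'(k,1) - cos k · y(k,1)` of the problem
`y'' + k² n y = 0`, `y(0) = 0`. -/
def charFunY (y y' : ℂ → ℝ → ℂ) (k : ℂ) : ℂ :=
  divVar Complex.sin k * y' k 1 - Complex.cos k * y k 1

/-- `a(k) = n(1)^{1/4} sin k / k`. -/
def coeffA (n : ℝ → ℝ) (k : ℂ) : ℂ :=
  ((n 1 ^ (1 / 4 : ℝ) : ℝ) : ℂ) * divVar Complex.sin k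

/-- `b(k) = -(cos k / n(1)^{1/4} + n'(1) sin k / (4 n(1)^{5/4} k))`. -/
def coeffB (n n' : ℝ → ℝ) (k : ℂ) : ℂ :=
  -(Complex.cos k / ((n 1 ^ (1 / 4 : ℝ) : ℝ) : ℂ)
    + ((n' 1 / (4 * n 1 ^ (5 / 4 : ℝ)) : ℝ) : ℂ) * divVar Complex.sin k)

/-- `D₀(k) = a(k) φ(k,δ) + b(k) S(k,δ)`. -/
def charFunD (n n' : ℝ → ℝ) (φ S : ℂ → ℝ → ℂ) (k : ℂ) : ℂ :=
  coeffA n k * φ k (travelTime n) + coeffB n n' k * S k (travelTime n)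

/-- `D_{0,N}(k) = a(k) φ_N(k,δ) + b(k) S_N(k,δ)`. -/
def charFunDTrunc (n n' : ℝ → ℝ) (φ S : ℂ → ℝ → ℂ) (N : ℕ) (k : ℂ) : ℂ :=
  coeffA n k * phiTrunc φ N k (travelTime n) + coeffB n n' k * sTrunc S N k (travelTime n)

/-! ### Simple closed curves and numbers of zeros -/

/-- `γ`, restricted to `[0,1]`, is a simple closed curve in the plane. -/
structure IsSimpleClosedCurve (γ : ℝ → ℂ) : Prop where
  cont : ContinuousOn γ (Icc 0 1)
  closed : γ 0 = γ 1
  simple : InjOn γ (Ico 0 1)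

/-- The inside of a closed curve with trace `Γ`: the points off `Γ` whose connected component
in the complement of `Γ` is bounded. -/
def insideOf (Γ : Set ℂ) : Set ℂ :=
  {z | z ∈ Γᶜ ∧ Bornology.IsBounded (connectedComponentIn Γᶜ z)}

/-- `f` is analytic on `U` and has exactly `m` zeros in `U`, counted with multiplicity. -/
def HasZeroCount (f : ℂ → ℂ) (U : Set ℂ) (m : ℕ) : Prop :=
  AnalyticOnNhd ℂ f U ∧ {z ∈ U | f z = 0}.Finite ∧
    ∑ᶠ z ∈ {z ∈ U | f z = 0}, analyticOrderNatAt f z = m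

/-! ### The series coefficients are the ones defined above -/

theorem sphericalBesselJ_series_differentiable (n : ℕ) : Differentiable ℂ (fun z : ℂ =>
    ∑' m : ℕ, (-1) ^ m * (z ^ 2 / 2) ^ m / ((m.factorial : ℂ) * ((2 * n + 2 * m + 1).doubleFactorial : ℂ))) := by
  intro z₀
  have hu : Summable (fun m : ℕ => ((‖z₀‖ + 1) ^ 2 / 2) ^ m / (m.factorial : ℝ)) :=
    Real.summable_pow_div_factorial _
  have key := Complex.differentiableOn_tsum_of_summable_norm (U := Metric.ball (0 : ℂ) (‖z₀‖ + 1))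
    (F := fun (m : ℕ) (z : ℂ) =>
      (-1) ^ m * (z ^ 2 / 2) ^ m / ((m.factorial : ℂ) * ((2 * n + 2 * m + 1).doubleFactorial : ℂ)))
    hu (fun m => by fun_prop) Metric.isOpen_ball ?_
  · exact key.differentiableAt (Metric.isOpen_ball.mem_nhds (by simp))
  · intro m w hw
    have hw' : ‖w‖ ≤ ‖z₀‖ + 1 := by simpa using (mem_ball_zero_iff.mp hw).le
    have h1 : (1 : ℝ) ≤ ((2 * n + 2 * m + 1).doubleFactorial : ℝ) := by
      exact_mod_cast Nat.doubleFactorial_pos _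
    have hf : (0 : ℝ) < (m.factorial : ℝ) := by exact_mod_cast Nat.factorial_pos _
    simp only [norm_div, norm_mul, norm_pow, norm_neg, norm_one, one_pow, one_mul,
      Complex.norm_natCast, Complex.norm_ofNat]
    have h2 : (m.factorial : ℝ) ≤ (m.factorial : ℝ) * ((2 * n + 2 * m + 1).doubleFactorial : ℝ) := by nlinarith
    gcongr

theorem sphericalBesselJ_differentiable (n : ℕ) : Differentiable ℂ (sphericalBesselJ n) :=
  (differentiable_id.pow n).mul (sphericalBesselJ_series_differentiable n)

theorem sphericalBesselJ_order (n : ℕ) : analyticOrderAt (sphericalBesselJ n) 0 = n := by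
  have ha : AnalyticAt ℂ (sphericalBesselJ n) 0 := (sphericalBesselJ_differentiable n).analyticAt 0
  rw [ha.analyticOrderAt_eq_natCast]
  refine ⟨_, (sphericalBesselJ_series_differentiable n).analyticAt 0, ?_,
    Eventually.of_forall fun z => by simp [sphericalBesselJ]⟩
  rw [tsum_eq_single 0]
  · have : ((2 * n + 1).doubleFactorial : ℂ) ≠ 0 := by exact_mod_cast (Nat.doubleFactorial_pos _).ne'
    simpa using this
  · intro m hm
    simp [hm]

theorem iteratedDeriv_sphericalBesselJ_of_lt {m n : ℕ} (h : m < n) :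
    iteratedDeriv m (sphericalBesselJ n) 0 = 0 := by
  have ha : AnalyticAt ℂ (sphericalBesselJ n) 0 := (sphericalBesselJ_differentiable n).analyticAt 0
  exact (natCast_le_analyticOrderAt_iff_iteratedDeriv_eq_zero ha).mp
    (sphericalBesselJ_order n).ge m h

theorem iteratedDeriv_sphericalBesselJ_self (n : ℕ) :
    iteratedDeriv n (sphericalBesselJ n) 0 ≠ 0 := by
  have ha : AnalyticAt ℂ (sphericalBesselJ n) 0 := (sphericalBesselJ_differentiable n).analyticAt 0
  intro h0
  have h : ((n + 1 : ℕ) : ℕ∞) ≤ analyticOrderAt (sphericalBesselJ n) 0 := by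
    rw [natCast_le_analyticOrderAt_iff_iteratedDeriv_eq_zero ha]
    intro i hi
    rcases (Nat.lt_succ_iff_lt_or_eq.mp hi) with h' | rfl
    · exact iteratedDeriv_sphericalBesselJ_of_lt h'
    · exact h0
  rw [sphericalBesselJ_order] at h
  have : n + 1 ≤ n := by exact_mod_cast h
  omega

theorem tendsto_iteratedDeriv_of_locallyUniform {f : ℕ → ℂ → ℂ} {F : ℂ → ℂ}
    (hf : ∀ N, Differentiable ℂ (f N)) (h : TendstoLocallyUniformlyOn f F atTop univ) (m : ℕ) :
    TendstoLocallyUniformlyOn (fun N => iteratedDeriv m (f N)) (iteratedDeriv m F) atTop univ := by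
  induction m with
  | zero => simpa using h
  | succ m ih =>
    have hd : ∀ N, DifferentiableOn ℂ (iteratedDeriv m (f N)) univ := fun N =>
      ((hf N).contDiff (n := (m + 1 : ℕ))).differentiable_iteratedDeriv m
        (by exact_mod_cast Nat.lt_succ_self m) |>.differentiableOn
    simp only [iteratedDeriv_succ]
    exact ih.deriv (Eventually.of_forall hd) isOpen_univ

/-- If the Neumann series `∑ a_m j_m(z)` converges to `F` locally uniformly, then `a` is the
sequence `neumannCoeff F`. -/
theorem neumannCoeff_eq {a : ℕ → ℂ} {F : ℂ → ℂ} {M : ℕ → ℕ} (hM : Tendsto M atTop atTop)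
    (h : TendstoLocallyUniformlyOn
      (fun N z => ∑ i ∈ Finset.range (M N), a i * sphericalBesselJ i z) F atTop univ) (m : ℕ) :
    a m = neumannCoeff F m := by
  have hj : ∀ i m : ℕ, ContDiffAt ℂ m (sphericalBesselJ i) 0 := fun i m =>
    (sphericalBesselJ_differentiable i).contDiff.contDiffAt
  have hF : ∀ m : ℕ, iteratedDeriv m F 0
      = ∑ i ∈ Finset.range (m + 1), a i * iteratedDeriv m (sphericalBesselJ i) 0 := by
    intro m
    have ht := (tendsto_iteratedDeriv_of_locallyUniform (fun N => by
      have := sphericalBesselJ_differentiable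
      fun_prop) h m).tendsto_at (mem_univ (0 : ℂ))
    refine tendsto_nhds_unique ht (tendsto_const_nhds.congr' ?_)
    filter_upwards [hM.eventually_ge_atTop (m + 1)] with N hN
    rw [iteratedDeriv_fun_sum (fun i _ => contDiffAt_const.mul (hj i m))]
    simp only [iteratedDeriv_const_mul_field]
    refine Finset.sum_subset (Finset.range_mono hN) fun i _ hi => ?_
    rw [iteratedDeriv_sphericalBesselJ_of_lt (by simpa using hi), mul_zero]
  induction m using Nat.strong_induction_on with
  | _ m ih =>
    rw [neumannCoeff, eq_div_iff (iteratedDeriv_sphericalBesselJ_self m), hF m,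
      Finset.sum_range_succ, ← Fin.sum_univ_eq_sum_range
        (fun i => a i * iteratedDeriv m (sphericalBesselJ i) 0)]
    have : ∑ i : Fin m, a i * iteratedDeriv m (sphericalBesselJ i) 0
        = ∑ i : Fin m, neumannCoeff F i * iteratedDeriv m (sphericalBesselJ i) 0 :=
      Finset.sum_congr rfl fun i _ => by rw [ih i i.2]
    rw [this]
    ring

theorem nsbfG_eq {φ : ℂ → ℝ → ℂ} {x : ℝ} (hx : 0 < x) {g : ℕ → ℂ}
    (h : TendstoLocallyUniformlyOn (fun (N : ℕ) (ρ : ℂ) => Complex.cos (ρ * x)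
      + ∑ n ∈ Finset.range N, g n * sphericalBesselJ (2 * n) (ρ * x))
      (fun ρ => φ ρ x) atTop univ) (n : ℕ) : g n = nsbfG φ x n := by
  have hx' : (x : ℂ) ≠ 0 := by exact_mod_cast hx.ne'
  have h1 := h.comp (fun z : ℂ => z / x) (mapsTo_univ _ univ) (by fun_prop)
  have h2 : TendstoLocallyUniformlyOn (fun (N : ℕ) (z : ℂ) => ∑ i ∈ Finset.range (2 * N),
      (if Even i then g (i / 2) else 0) * sphericalBesselJ i z)
      (fun z => φ (z / x) x - Complex.cos z) atTop univ := by
    rw [Metric.tendstoLocallyUniformlyOn_iff] at h1 ⊢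
    intro ε hε z hz
    obtain ⟨t, ht, H⟩ := h1 ε hε z hz
    refine ⟨t, ht, H.mono fun N hN w hw => ?_⟩
    have := hN w hw
    have hs : ∑ i ∈ Finset.range (2 * N), (if Even i then g (i / 2) else 0) * sphericalBesselJ i w
        = ∑ n ∈ Finset.range N, g n * sphericalBesselJ (2 * n) w := by
      clear this hN
      induction N with
      | zero => simp
      | succ N ih =>
        rw [show 2 * (N + 1) = 2 * N + 1 + 1 by ring, Finset.sum_range_succ,
          Finset.sum_range_succ, ih, Finset.sum_range_succ]
        simp
    simp only [Function.comp, div_mul_cancel₀ _ hx'] at this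
    rw [hs, dist_eq_norm]
    rw [dist_eq_norm] at this
    convert this using 2
    ring
  have := neumannCoeff_eq (tendsto_id.const_mul_atTop' (by norm_num : 0 < 2)) h2 (2 * n)
  simpa [nsbfG] using this

theorem nsbfS_eq {S : ℂ → ℝ → ℂ} {x : ℝ} (hx : 0 < x) {s : ℕ → ℂ}
    (h : TendstoLocallyUniformlyOn (fun (N : ℕ) (ρ : ℂ) => Complex.sin (ρ * x)
      + ∑ n ∈ Finset.range N, s n * sphericalBesselJ (2 * n + 1) (ρ * x))
      (fun ρ => ρ * S ρ x) atTop univ) (n : ℕ) : s n = nsbfS S x n := by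
  have hx' : (x : ℂ) ≠ 0 := by exact_mod_cast hx.ne'
  have h1 := h.comp (fun z : ℂ => z / x) (mapsTo_univ _ univ) (by fun_prop)
  have h2 : TendstoLocallyUniformlyOn (fun (N : ℕ) (z : ℂ) => ∑ i ∈ Finset.range (2 * N),
      (if Even i then 0 else s (i / 2)) * sphericalBesselJ i z)
      (fun z => z / x * S (z / x) x - Complex.sin z) atTop univ := by
    rw [Metric.tendstoLocallyUniformlyOn_iff] at h1 ⊢
    intro ε hε z hz
    obtain ⟨t, ht, H⟩ := h1 ε hε z hz
    refine ⟨t, ht, H.mono fun N hN w hw => ?_⟩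
    have := hN w hw
    have hs : ∑ i ∈ Finset.range (2 * N), (if Even i then 0 else s (i / 2)) * sphericalBesselJ i w
        = ∑ n ∈ Finset.range N, s n * sphericalBesselJ (2 * n + 1) w := by
      clear this hN
      induction N with
      | zero => simp
      | succ N ih =>
        rw [show 2 * (N + 1) = 2 * N + 1 + 1 by ring, Finset.sum_range_succ,
          Finset.sum_range_succ, ih, Finset.sum_range_succ]
        have : (2 * N + 1) / 2 = N := by omega
        simp [this]
    simp only [Function.comp, div_mul_cancel₀ _ hx'] at this
    rw [hs, dist_eq_norm]
    rw [dist_eq_norm] at this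
    convert this using 2
    ring
  have := neumannCoeff_eq (tendsto_id.const_mul_atTop' (by norm_num : 0 < 2)) h2 (2 * n + 1)
  have h3 : (2 * n + 1) / 2 = n := by omega
  simpa [nsbfS, h3] using this

end

/-!
The argument combines three facts.

*Rouché.* On the curve `Γ` one has `|D₀ - D_{0,N}| < ε < |D_{0,N}|`. The inside of `Γ` is a bounded
open set `U` with frontier contained in `Γ`, and this is all that is needed: neither the Jordan
curve theorem nor winding numbers enter. On a disc, Rouché's theorem follows from the argument
principle, since `f / g` has a logarithm on the circle (`zeroCount_ball_eq`). Small discs about the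
zeros show that the number of zeros in `U` is stable under perturbations that are uniformly small on
`closure U` (`exists_zeroCount_eq_of_near`), hence constant along the homotopy `g + t (f - g)`
(`zeroCount_eq_of_norm_sub_lt`).

*Analyticity.* The truncation `D_{0,N}` is a finite combination of entire functions. For `D₀` one
needs that `φ(k,δ)` and `S(k,δ)` are entire. By constancy of Wronskians up to an integral term, two
solutions for the parameters `k²` and `l²` satisfy the variation of constants formula
`solution_sub_eq`, with a factor `k² - l²` in front of a bounded integral operator. This gives first
the uniform convergence `u(l,·) → u(k,·)` as `l → k` and then the complex derivative
(`differentiable_solution`).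

*Liouville transformation.* For a solution `u` of `-u'' + p u = k² u` the Wronskian of `u` and
`n^{1/4} y` in the variable `ζ` is constant, so that its values at the two ends express `u(δ)` by
`y(1)` and `y'(1)` (`IsRefractiveIndex.solution_travelTime_eq`). For `u = φ` and `u = S` this yields
`D₀ = n(0)^{1/4} ((sin k / k) y'(k,1) - cos k y(k,1))` (`IsRefractiveIndex.charFunD_eq`).

As `n''` and `p` are merely integrable, the Wronskians are differentiated with the calculus of
absolutely continuous functions, in the form `HasACDeriv`.
-/

/-! ### Zeros of entire functions in bounded sets -/

open Metric Complex in
theorem entire_zeros_finite {f : ℂ → ℂ} (hf : Differentiable ℂ f) {x : ℂ} (hx : f x ≠ 0)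
    {A : Set ℂ} (hA : Bornology.IsBounded A) : {z ∈ A | f z = 0}.Finite := by
  by_contra hinf
  obtain ⟨z, -, hz⟩ := Set.Infinite.exists_accPt_of_subset_isCompact hinf hA.isCompact_closure
    ((sep_subset _ _).trans subset_closure)
  have hfr : ∃ᶠ w in 𝓝[≠] z, f w = 0 :=
    (accPt_iff_frequently_nhdsNE.1 hz).mono fun w hw => hw.2
  have := AnalyticOnNhd.eqOn_zero_of_preconnected_of_frequently_eq_zero
    (U := univ) (fun w _ => hf.analyticAt w) isPreconnected_univ (mem_univ z) hfr
  exact hx (this (mem_univ x))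

theorem analyticOrderAt_ne_top_of_entire {f : ℂ → ℂ} (hf : Differentiable ℂ f) {x : ℂ}
    (hx : f x ≠ 0) (z : ℂ) : analyticOrderAt f z ≠ ⊤ := by
  rw [Ne, AnalyticOnNhd.analyticOrderAt_eq_top_iff_eq_zero z hf.analyticAt]
  rintro rfl
  exact hx rfl

theorem analyticOrderNatAt_of_ne_zero {f : ℂ → ℂ} {z : ℂ} (h : f z ≠ 0) :
    analyticOrderNatAt f z = 0 := by
  simp [analyticOrderNatAt, analyticOrderAt_eq_zero.2 (Or.inr h)]

theorem analyticOrderNatAt_ne_zero_of_entire {f : ℂ → ℂ} (hf : Differentiable ℂ f) {x : ℂ}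
    (hx : f x ≠ 0) {z : ℂ} (hz : f z = 0) : analyticOrderNatAt f z ≠ 0 := by
  have h1 := analyticOrderAt_ne_top_of_entire hf hx z
  have h2 : analyticOrderAt f z ≠ 0 := analyticOrderAt_ne_zero.2 ⟨hf.analyticAt z, hz⟩
  simp [analyticOrderNatAt, h1, h2]

/-- The number of zeros of `f` in `A`, counted with multiplicity. Points that are not zeros have
order zero, so that the sum may run over all of `A`. -/
noncomputable def zeroCount (f : ℂ → ℂ) (A : Set ℂ) : ℕ := ∑ᶠ z ∈ A, analyticOrderNatAt f z

theorem finite_inter_support_order {f : ℂ → ℂ} (hf : Differentiable ℂ f) {x : ℂ} (hx : f x ≠ 0)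
    {A : Set ℂ} (hA : Bornology.IsBounded A) :
    (A ∩ Function.support (analyticOrderNatAt f)).Finite :=
  (entire_zeros_finite hf hx hA).subset fun _ hz =>
    ⟨hz.1, by_contra fun h => hz.2 (analyticOrderNatAt_of_ne_zero h)⟩

theorem zeroCount_eq_zeros (f : ℂ → ℂ) (A : Set ℂ) :
    ∑ᶠ z ∈ {z ∈ A | f z = 0}, analyticOrderNatAt f z = zeroCount f A := by
  refine finsum_mem_inter_support_eq' _ _ _ fun z hz => ⟨fun h => h.1, fun h => ⟨h, ?_⟩⟩
  exact by_contra fun h0 => hz (analyticOrderNatAt_of_ne_zero h0)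

theorem zeroCount_of_forall_ne {f : ℂ → ℂ} {A : Set ℂ} (h : ∀ z ∈ A, f z ≠ 0) :
    zeroCount f A = 0 :=
  finsum_mem_eq_zero_of_forall_eq_zero fun z hz => analyticOrderNatAt_of_ne_zero (h z hz)

theorem differentiable_dslope {f : ℂ → ℂ} (hf : Differentiable ℂ f) (a : ℂ) :
    Differentiable ℂ (dslope f a) :=
  differentiableOn_univ.1 ((Complex.differentiableOn_dslope univ_mem).2 hf.differentiableOn)

/-- Dividing out one zero `a ∈ A` lowers the number of zeros in `A` by one. -/
theorem zeroCount_sub_mul {g : ℂ → ℂ} (hg : Differentiable ℂ g) {x : ℂ} (hx : g x ≠ 0)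
    {A : Set ℂ} (hA : Bornology.IsBounded A) {a : ℂ} (ha : a ∈ A) :
    zeroCount (fun z => (z - a) * g z) A = 1 + zeroCount g A := by
  have hord : ∀ z, analyticOrderNatAt (fun z => (z - a) * g z) z
      = analyticOrderNatAt (fun z => z - a) z + analyticOrderNatAt g z := fun z => by
    refine analyticOrderNatAt_mul (by fun_prop) (hg.analyticAt z) ?_
      (analyticOrderAt_ne_top_of_entire hg hx z)
    exact analyticOrderAt_ne_top_of_entire (x := a + 1) (by fun_prop) (by simp) z
  unfold zeroCount
  rw [finsum_mem_congr rfl fun z _ => hord z, finsum_mem_add_distrib'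
    (finite_inter_support_order (x := a + 1) (by fun_prop) (by simp) hA)
    (finite_inter_support_order hg hx hA)]
  congr 1
  rw [← finsum_mem_inter_support_eq' _ {a} A]
  · rw [finsum_mem_singleton]
    have : analyticOrderAt (fun z => z - a) a = 1 := analyticOrderAt_id_sub_const_self
    simp [analyticOrderNatAt, this]
  · intro z hz
    refine ⟨fun h => by rwa [mem_singleton_iff.1 h], fun _ => ?_⟩
    by_contra hne
    exact hz (analyticOrderNatAt_of_ne_zero (sub_ne_zero.2 hne))

/-! ### The argument principle and Rouché's theorem -/

open Complex Metric in
/-- The argument principle for an entire function on a disc. -/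
theorem circleIntegral_logDeriv {f : ℂ → ℂ} (hf : Differentiable ℂ f) {c : ℂ} {R : ℝ} (hR : 0 < R)
    (hs : ∀ z ∈ sphere c R, f z ≠ 0) :
    (∮ z in C(c, R), deriv f z / f z) = 2 * Real.pi * I * zeroCount f (ball c R) := by
  have hxs : c + R ∈ sphere c R := by simp [hR.le]
  induction hN : zeroCount f (ball c R) generalizing f with
  | zero =>
    have hne : ∀ z ∈ closedBall c R, f z ≠ 0 := by
      intro z hz h0
      rcases (mem_closedBall.1 hz).lt_or_eq with h | h
      · have hfin := finite_inter_support_order hf (hs _ hxs) (isBounded_ball (x := c) (r := R))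
        rw [zeroCount, ← finsum_mem_inter_support, finsum_mem_eq_finite_toFinset_sum _ hfin,
          Finset.sum_eq_zero_iff] at hN
        have h1 := analyticOrderNatAt_ne_zero_of_entire hf (hs _ hxs) h0
        exact h1 (hN z (by simpa using ⟨h, h1⟩))
      · exact hs z h h0
    simp only [Nat.cast_zero, mul_zero]
    refine circleIntegral_eq_zero_of_differentiable_on_off_countable hR.le countable_empty
      (hf.deriv.continuous.continuousOn.div hf.continuous.continuousOn hne) fun z hz => ?_
    exact (hf.deriv z).div (hf z) (hne z (ball_subset_closedBall hz.1))
  | succ N ih =>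
    obtain ⟨a, ha, h0⟩ : ∃ a ∈ ball c R, f a = 0 := by
      by_contra! h
      rw [zeroCount_of_forall_ne h] at hN
      omega
    set g := dslope f a
    have hg : Differentiable ℂ g := differentiable_dslope hf a
    have hfg : f = fun z => (z - a) * g z := by
      ext z
      have := sub_smul_dslope f a z
      rw [h0, sub_zero] at this
      exact this.symm
    have hsub : ∀ z ∈ sphere c R, z - a ≠ 0 := by
      rintro z hz h
      exact hs z hz (by rw [sub_eq_zero.1 h, h0])
    have hgs : ∀ z ∈ sphere c R, g z ≠ 0 := by
      intro z hz h
      refine hs z hz ?_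
      rw [hfg]
      simp [h]
    rw [hfg, zeroCount_sub_mul hg (hgs _ hxs) isBounded_ball ha] at hN
    have hd : EqOn (fun z => deriv f z / f z) (fun z => (z - a)⁻¹ + deriv g z / g z)
        (sphere c R) := by
      intro z hz
      have h1 : HasDerivAt f (1 * g z + (z - a) * deriv g z) z := by
        rw [hfg]
        exact ((hasDerivAt_id z).sub_const a).mul (hg z).hasDerivAt
      have h2 := hsub z hz
      have h3 := hgs z hz
      have h4 : f z = (z - a) * g z := congrFun hfg z
      simp only [h1.deriv, h4]
      field_simp
    rw [circleIntegral.integral_congr hR.le hd, circleIntegral.integral_add,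
      circleIntegral.integral_sub_inv_of_mem_ball ha, ih hg hgs (by omega)]
    · push_cast
      ring
    · exact ContinuousOn.circleIntegrable hR.le
        ((continuous_id.sub continuous_const).continuousOn.inv₀ hsub)
    · exact ContinuousOn.circleIntegrable hR.le
        (hg.deriv.continuous.continuousOn.div hg.continuous.continuousOn hgs)

theorem ne_zero_of_norm_sub_lt {a b : ℂ} (h : ‖a - b‖ < ‖b‖) : a ≠ 0 ∧ b ≠ 0 := by
  refine ⟨?_, norm_pos_iff.1 ((norm_nonneg _).trans_lt h)⟩
  rintro rfl
  simp at h

open Complex Metric in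
/-- Rouché's theorem on a disc: on the circle the quotient `f / g` stays in the disc of radius one
about `1`, so that it has a logarithm there. -/
theorem zeroCount_ball_eq {f g : ℂ → ℂ} (hf : Differentiable ℂ f) (hg : Differentiable ℂ g)
    {c : ℂ} {R : ℝ} (hR : 0 < R) (h : ∀ z ∈ sphere c R, ‖f z - g z‖ < ‖g z‖) :
    zeroCount f (ball c R) = zeroCount g (ball c R) := by
  have hfs : ∀ z ∈ sphere c R, f z ≠ 0 := fun z hz => (ne_zero_of_norm_sub_lt (h z hz)).1
  have hgs : ∀ z ∈ sphere c R, g z ≠ 0 := fun z hz => (ne_zero_of_norm_sub_lt (h z hz)).2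
  have key : (∮ z in C(c, R), (deriv f z / f z - deriv g z / g z)) = 0 := by
    refine circleIntegral.integral_eq_zero_of_hasDerivWithinAt hR.le
      (f := fun z => Complex.log (f z / g z)) fun z hz => ?_
    have hz1 := hfs z hz
    have hz2 := hgs z hz
    have hslit : f z / g z ∈ slitPlane := by
      have : f z / g z = 1 + (f z - g z) / g z := by field_simp; ring
      rw [this]
      refine mem_slitPlane_of_norm_lt_one ?_
      rw [norm_div, div_lt_one (norm_pos_iff.2 hz2)]
      exact h z hz
    have := (((hf z).hasDerivAt.fun_div (hg z).hasDerivAt hz2).clog hslit).hasDerivWithinAt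
      (s := sphere c R)
    convert this using 1
    field_simp
  have hint : ∀ u : ℂ → ℂ, Differentiable ℂ u → (∀ z ∈ sphere c R, u z ≠ 0) →
      CircleIntegrable (fun z => deriv u z / u z) c R := fun u hu hus =>
    ContinuousOn.circleIntegrable hR.le
      (hu.deriv.continuous.continuousOn.div hu.continuous.continuousOn hus)
  rw [circleIntegral.integral_sub (hint f hf hfs) (hint g hg hgs),
    circleIntegral_logDeriv hf hR hfs, circleIntegral_logDeriv hg hR hgs, ← mul_sub] at key
  have h2 : (2 * Real.pi * I : ℂ) ≠ 0 := Complex.two_pi_I_ne_zero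
  have := sub_eq_zero.1 ((mul_eq_zero.1 key).resolve_left h2)
  exact_mod_cast this

open Metric in
/-- The number of zeros in a bounded open set is stable under perturbations that are uniformly
small on its closure. -/
theorem exists_zeroCount_eq_of_near {g : ℂ → ℂ} (hg : Differentiable ℂ g) {x : ℂ} (hx : g x ≠ 0)
    {U : Set ℂ} (hU : IsOpen U) (hb : Bornology.IsBounded U) (hfr : ∀ z ∈ frontier U, g z ≠ 0) :
    ∃ c > 0, ∀ f : ℂ → ℂ, Differentiable ℂ f → (∀ z ∈ closure U, ‖f z - g z‖ < c) →
      zeroCount f U = zeroCount g U := by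
  set Z := {z ∈ U | g z = 0}
  have hZfin : Z.Finite := entire_zeros_finite hg hx hb
  obtain ⟨r, hr0, hrU, hrd⟩ : ∃ r > 0, (∀ z ∈ Z, closedBall z r ⊆ U) ∧
      ∀ z ∈ Z, ∀ w ∈ Z, z ≠ w → Disjoint (closedBall z r) (closedBall w r) := by
    have h1 : ∀ᶠ r in 𝓝[>] (0 : ℝ), ∀ z ∈ Z, closedBall z r ⊆ U := by
      rw [eventually_all_finite hZfin]
      intro z hz
      obtain ⟨ε, hε, h⟩ := nhds_basis_closedBall.mem_iff.1 (hU.mem_nhds hz.1)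
      filter_upwards [Ioo_mem_nhdsGT hε] with r hr
      exact (closedBall_subset_closedBall hr.2.le).trans h
    have h2 : ∀ᶠ r in 𝓝[>] (0 : ℝ), ∀ z ∈ Z, ∀ w ∈ Z, z ≠ w →
        Disjoint (closedBall z r) (closedBall w r) := by
      rw [eventually_all_finite hZfin]
      intro z _
      rw [eventually_all_finite hZfin]
      intro w _
      by_cases hzw : z = w
      · exact Eventually.of_forall fun _ h => absurd hzw h
      · filter_upwards [Ioo_mem_nhdsGT (half_pos (dist_pos.2 hzw))] with r hr _
        exact closedBall_disjoint_closedBall (by linarith [hr.2])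
    obtain ⟨r, ⟨h1, h2⟩, h3⟩ := ((h1.and h2).and self_mem_nhdsWithin).exists
    exact ⟨r, h3, h1, h2⟩
  set K := closure U \ ⋃ z ∈ Z, ball z r
  have hKc : IsCompact K :=
    hb.isCompact_closure.diff (isOpen_biUnion fun _ _ => isOpen_ball)
  have hKne : ∀ z ∈ K, g z ≠ 0 := by
    intro z hz h0
    by_cases hzU : z ∈ U
    · exact hz.2 (mem_biUnion (show z ∈ Z from ⟨hzU, h0⟩) (mem_ball_self hr0))
    · exact hfr z ⟨hz.1, by rwa [hU.interior_eq]⟩ h0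
  obtain ⟨c, hc0, hc⟩ : ∃ c > 0, ∀ z ∈ K, c ≤ ‖g z‖ := by
    rcases K.eq_empty_or_nonempty with h | h
    · exact ⟨1, one_pos, by simp [h]⟩
    · obtain ⟨z, hz, hm⟩ := hKc.exists_isMinOn h hg.continuous.norm.continuousOn
      exact ⟨‖g z‖, norm_pos_iff.2 (hKne z hz), fun w hw => hm hw⟩
  have hsph : ∀ z ∈ Z, sphere z r ⊆ K := by
    intro z hz w hw
    refine ⟨subset_closure (hrU z hz (sphere_subset_closedBall hw)), ?_⟩
    simp only [mem_iUnion, not_exists]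
    intro v hv hwv
    by_cases hzv : z = v
    · subst hzv
      exact (mem_ball.1 hwv).ne hw
    · exact disjoint_left.1 (hrd z hz v hv hzv) (sphere_subset_closedBall hw)
        (ball_subset_closedBall hwv)
  -- A function without zeros on `K` has all its zeros in the small discs.
  have hsplit : ∀ f : ℂ → ℂ, Differentiable ℂ f → (∀ z ∈ K, f z ≠ 0) →
      zeroCount f U = ∑ᶠ z ∈ Z, zeroCount f (ball z r) := by
    intro f hf hfK
    have hfin : ∀ z ∈ Z, (ball z r ∩ Function.support (analyticOrderNatAt f)).Finite := fun z hz =>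
      finite_inter_support_order hf (hfK (z + r) (hsph z hz (by simp [hr0.le]))) isBounded_ball
    have hrhs : ∑ᶠ z ∈ Z, zeroCount f (ball z r)
        = ∑ᶠ z ∈ Z, ∑ᶠ w ∈ ball z r ∩ Function.support (analyticOrderNatAt f),
          analyticOrderNatAt f w :=
      finsum_mem_congr rfl fun z _ => (finsum_mem_inter_support _ _).symm
    rw [hrhs, ← finsum_mem_biUnion _ hZfin hfin]
    · refine finsum_mem_inter_support_eq' _ _ _ fun w hw => ⟨fun hwU => ?_, fun h => ?_⟩
      · have h0 : f w = 0 := by_contra fun h => hw (analyticOrderNatAt_of_ne_zero h)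
        have : w ∈ ⋃ z ∈ Z, ball z r :=
          by_contra fun h => hfK w ⟨subset_closure hwU, h⟩ h0
        obtain ⟨z, hz, hwz⟩ := mem_iUnion₂.1 this
        exact mem_biUnion hz ⟨hwz, hw⟩
      · obtain ⟨z, hz, hwz⟩ := mem_iUnion₂.1 h
        exact hrU z hz (ball_subset_closedBall hwz.1)
    · intro z hz w hw hzw
      exact (hrd z hz w hw hzw).mono (inter_subset_left.trans ball_subset_closedBall)
        (inter_subset_left.trans ball_subset_closedBall)
  refine ⟨c, hc0, fun f hf hfg => ?_⟩
  have hlt : ∀ z ∈ K, ‖f z - g z‖ < ‖g z‖ := fun z hz => (hfg z hz.1).trans_le (hc z hz)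
  rw [hsplit f hf fun z hz => (ne_zero_of_norm_sub_lt (hlt z hz)).1, hsplit g hg hKne]
  exact finsum_mem_congr rfl fun z hz =>
    zeroCount_ball_eq hf hg hr0 fun w hw => hlt w (hsph z hz hw)

/-- Rouché's theorem for a bounded open set, by the homotopy `g + t (f - g)`. -/
theorem zeroCount_eq_of_norm_sub_lt {f g : ℂ → ℂ} (hf : Differentiable ℂ f)
    (hg : Differentiable ℂ g) {U : Set ℂ} (hU : IsOpen U) (hb : Bornology.IsBounded U)
    (hne : (frontier U).Nonempty) (h : ∀ z ∈ frontier U, ‖f z - g z‖ < ‖g z‖) :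
    zeroCount f U = zeroCount g U := by
  obtain ⟨x, hx⟩ := hne
  let F : unitInterval → ℂ → ℂ := fun t z => g z + ((t : ℝ) : ℂ) * (f z - g z)
  have hF : ∀ t, Differentiable ℂ (F t) := fun t => hg.add ((hf.sub hg).const_mul _)
  have hFne : ∀ t, ∀ z ∈ frontier U, F t z ≠ 0 := by
    intro t z hz
    refine (ne_zero_of_norm_sub_lt (b := g z) ?_).1
    have h1 : ‖F t z - g z‖ = t * ‖f z - g z‖ := by
      simp [F, abs_of_nonneg t.2.1]
    rw [h1]
    exact (mul_le_of_le_one_left (norm_nonneg _) t.2.2).trans_lt (h z hz)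
  obtain ⟨M, hM⟩ := hb.isCompact_closure.exists_bound_of_continuousOn
    (hf.continuous.sub hg.continuous).continuousOn
  -- `M` bounds `‖f - g‖`, so that `F s` is uniformly close to `F t` when `s` is close to `t`.
  have hloc : IsLocallyConstant fun t => zeroCount (F t) U := by
    rw [IsLocallyConstant.iff_eventually_eq]
    intro t
    obtain ⟨c, hc, H⟩ := exists_zeroCount_eq_of_near (hF t) (hFne t x hx) hU hb (hFne t)
    have hcont : Tendsto (fun s : unitInterval => |(s : ℝ) - t| * M) (𝓝 t) (𝓝 0) := by
      have : Continuous fun s : unitInterval => |(s : ℝ) - t| * M := by fun_prop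
      simpa using this.tendsto t
    filter_upwards [hcont.eventually_lt_const hc] with s hs
    refine H _ (hF s) fun z hz => ?_
    have h1 : F s z - F t z = (((s : ℝ) - t : ℝ) : ℂ) * (f z - g z) := by
      simp only [F]
      push_cast
      ring
    rw [h1, norm_mul, Complex.norm_real, Real.norm_eq_abs]
    exact (mul_le_mul_of_nonneg_left (hM z hz) (abs_nonneg _)).trans_lt hs
  have := hloc.apply_eq_of_preconnectedSpace 1 0
  simpa [F] using this

/-! ### The inside of a compact set -/

theorem isOpen_insideOf {Γ : Set ℂ} (hΓ : IsClosed Γ) : IsOpen (insideOf Γ) := by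
  rw [isOpen_iff_mem_nhds]
  intro z hz
  refine mem_of_superset (hΓ.isOpen_compl.connectedComponentIn.mem_nhds
    (mem_connectedComponentIn hz.1)) fun w hw => ⟨connectedComponentIn_subset _ _ hw, ?_⟩
  rw [← connectedComponentIn_eq hw]
  exact hz.2

theorem frontier_insideOf_subset {Γ : Set ℂ} (hΓ : IsClosed Γ) : frontier (insideOf Γ) ⊆ Γ := by
  intro z hz
  by_contra hzΓ
  rw [(isOpen_insideOf hΓ).frontier_eq] at hz
  obtain ⟨w, hw, hwU⟩ := mem_closure_iff.1 hz.1 _ hΓ.isOpen_compl.connectedComponentIn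
    (mem_connectedComponentIn hzΓ)
  refine hz.2 ⟨hzΓ, ?_⟩
  rw [connectedComponentIn_eq hw]
  exact hwU.2

/-- The points inside `Γ` lie in every disc about the origin that contains `Γ`: from a point
outside such a disc a ray leads to infinity without meeting `Γ`. -/
theorem isBounded_insideOf {Γ : Set ℂ} (hΓ : Bornology.IsBounded Γ) :
    Bornology.IsBounded (insideOf Γ) := by
  obtain ⟨R, hR0, hR⟩ := hΓ.exists_pos_norm_le
  refine isBounded_iff_forall_norm_le.2 ⟨R, fun z hz => ?_⟩
  by_contra! hlt
  have hray : (fun t : ℝ => (t : ℂ) * z) '' Ici 1 ⊆ connectedComponentIn Γᶜ z := by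
    refine IsPreconnected.subset_connectedComponentIn
      (isPreconnected_Ici.image _ (by fun_prop)) ⟨1, self_mem_Ici, by simp⟩ ?_
    rintro _ ⟨t, ht, rfl⟩ hmem
    have h1 := hR _ hmem
    have ht' : (1 : ℝ) ≤ t := ht
    rw [norm_mul, Complex.norm_real, Real.norm_of_nonneg (by linarith)] at h1
    nlinarith
  obtain ⟨B, hB⟩ := isBounded_iff_forall_norm_le.1 (hz.2.subset hray)
  have h1 := hB _ ⟨|B| / R + 1, by simp; positivity, rfl⟩
  have h2 : (0 : ℝ) ≤ |B| / R := by positivity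
  rw [norm_mul, Complex.norm_real, Real.norm_of_nonneg (by linarith)] at h1
  have h3 : |B| / R * R = |B| := by field_simp
  nlinarith [le_abs_self B]

theorem hasZeroCount_of_entire {f : ℂ → ℂ} (hf : Differentiable ℂ f) {x : ℂ} (hx : f x ≠ 0)
    {U : Set ℂ} (hU : Bornology.IsBounded U) : HasZeroCount f U (zeroCount f U) :=
  ⟨fun z _ => hf.analyticAt z, entire_zeros_finite hf hx hU, zeroCount_eq_zeros f U⟩

/-- Rouché's theorem for the inside of a nonempty compact set. -/
theorem exists_hasZeroCount_insideOf {f g : ℂ → ℂ} (hf : Differentiable ℂ f)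
    (hg : Differentiable ℂ g) {Γ : Set ℂ} (hΓ : IsCompact Γ) (hne : Γ.Nonempty)
    (h : ∀ z ∈ Γ, ‖f z - g z‖ < ‖g z‖) :
    ∃ m, HasZeroCount f (insideOf Γ) m ∧ HasZeroCount g (insideOf Γ) m := by
  obtain ⟨x, hx⟩ := hne
  have hb := isBounded_insideOf hΓ.isBounded
  have hx' := ne_zero_of_norm_sub_lt (h x hx)
  refine ⟨zeroCount f (insideOf Γ), hasZeroCount_of_entire hf hx'.1 hb, ?_⟩
  rcases (insideOf Γ).eq_empty_or_nonempty with he | hin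
  · have : zeroCount f (insideOf Γ) = zeroCount g (insideOf Γ) := by simp [he, zeroCount]
    rw [this]
    exact hasZeroCount_of_entire hg hx'.2 hb
  · have hfr : (frontier (insideOf Γ)).Nonempty := by
      rw [nonempty_frontier_iff]
      refine ⟨hin, fun hu => ?_⟩
      rw [hu] at hb
      exact NormedSpace.unbounded_univ ℂ ℂ hb
    rw [zeroCount_eq_of_norm_sub_lt hf hg (isOpen_insideOf hΓ.isClosed) hb hfr
      fun z hz => h z (frontier_insideOf_subset hΓ.isClosed hz)]
    exact hasZeroCount_of_entire hg hx'.2 hb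

/-- Multiplying by a nonzero constant changes neither the zeros nor their multiplicities. -/
theorem HasZeroCount.const_mul {f : ℂ → ℂ} {U : Set ℂ} {m : ℕ} (h : HasZeroCount f U m) {c : ℂ}
    (hc : c ≠ 0) : HasZeroCount (fun z => c * f z) U m := by
  obtain ⟨h1, h2, h3⟩ := h
  have hset : {z ∈ U | c * f z = 0} = {z ∈ U | f z = 0} := by simp [hc]
  refine ⟨fun z hz => analyticAt_const.mul (h1 z hz), by rwa [hset], ?_⟩
  rw [hset, ← h3]
  refine finsum_mem_congr rfl fun z hz => ?_
  have h4 : analyticOrderAt (fun _ : ℂ => c) z = 0 := analyticOrderAt_eq_zero.2 (Or.inr hc)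
  have h5 := analyticOrderAt_mul (analyticAt_const (v := c)) (h1 z hz.1)
  rw [h4, zero_add] at h5
  exact congrArg ENat.toNat h5

/-! ### Absolutely continuous functions -/

/-- `f` is absolutely continuous on `[a,b]` with derivative `f'`, in the form that `f' ∈ L¹(a,b)`
and `f` is an indefinite integral of `f'`. -/
structure HasACDeriv (f f' : ℝ → ℂ) (a b : ℝ) : Prop where
  le : a ≤ b
  integrable : IntervalIntegrable f' volume a b
  eq_integral : ∀ x ∈ Icc a b, f x = f a + ∫ t in a..x, f' t

namespace HasACDeriv

variable {f f' g g' : ℝ → ℂ} {a b : ℝ}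

theorem integrable_of_mem (hf : HasACDeriv f f' a b) {x : ℝ} (hx : x ∈ Icc a b) :
    IntervalIntegrable f' volume a x :=
  hf.integrable.mono_set (by
    rw [uIcc_of_le hx.1, uIcc_of_le hf.le]
    exact Icc_subset_Icc_right hx.2)

theorem continuousOn (hf : HasACDeriv f f' a b) : ContinuousOn f (Icc a b) := by
  have h := intervalIntegral.continuousOn_primitive_interval' hf.integrable
    (left_mem_uIcc : a ∈ uIcc a b)
  rw [uIcc_of_le hf.le] at h
  exact (continuousOn_const.add h).congr fun x hx => hf.eq_integral x hx

theorem congr_deriv (hf : HasACDeriv f f' a b) (h : EqOn f' g' (Icc a b)) :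
    HasACDeriv f g' a b := by
  refine ⟨hf.le, hf.integrable.congr fun t ht => ?_, fun x hx => ?_⟩
  · rw [uIoc_of_le hf.le] at ht
    exact h (Ioc_subset_Icc_self ht)
  · rw [hf.eq_integral x hx, intervalIntegral.integral_congr fun t ht => ?_]
    rw [uIcc_of_le hx.1] at ht
    exact h ⟨ht.1, ht.2.trans hx.2⟩

theorem neg (hf : HasACDeriv f f' a b) :
    HasACDeriv (fun x => -f x) (fun x => -f' x) a b := by
  refine ⟨hf.le, hf.integrable.neg, fun x hx => ?_⟩
  rw [hf.eq_integral x hx, intervalIntegral.integral_neg]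
  ring

theorem add (hf : HasACDeriv f f' a b) (hg : HasACDeriv g g' a b) :
    HasACDeriv (fun x => f x + g x) (fun x => f' x + g' x) a b := by
  refine ⟨hf.le, hf.integrable.add hg.integrable, fun x hx => ?_⟩
  rw [intervalIntegral.integral_add (hf.integrable_of_mem hx) (hg.integrable_of_mem hx),
    hf.eq_integral x hx, hg.eq_integral x hx]
  ring

theorem sub (hf : HasACDeriv f f' a b) (hg : HasACDeriv g g' a b) :
    HasACDeriv (fun x => f x - g x) (fun x => f' x - g' x) a b := by
  simpa only [sub_eq_add_neg] using hf.add hg.neg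

end HasACDeriv

theorem integral_primitive_mul_real {f g : ℝ → ℝ} {a b : ℝ} (hf : IntervalIntegrable f volume a b)
    (hg : IntervalIntegrable g volume a b) :
    ∫ x in a..b, (f x * (∫ t in a..x, g t) + (∫ t in a..x, f t) * g x)
      = (∫ t in a..b, f t) * ∫ t in a..b, g t := by
  have hF := hf.absolutelyContinuousOnInterval_intervalIntegral (c := a) left_mem_uIcc
  have hG := hg.absolutelyContinuousOnInterval_intervalIntegral (c := a) left_mem_uIcc
  have h := hF.integral_deriv_mul_eq_sub hG
  simp only [intervalIntegral.integral_same, zero_mul, sub_zero] at h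
  rw [← h]
  refine intervalIntegral.integral_congr_ae ?_
  filter_upwards [hf.ae_hasDerivAt_integral, hg.ae_hasDerivAt_integral] with x h1 h2 hx
  have hx' := uIoc_subset_uIcc hx
  rw [(h1 hx' a left_mem_uIcc).deriv, (h2 hx' a left_mem_uIcc).deriv]

theorem intervalIntegrable_re {f : ℝ → ℂ} {a b : ℝ} (hf : IntervalIntegrable f volume a b) :
    IntervalIntegrable (fun t => (f t).re) volume a b :=
  ⟨hf.1.re, hf.2.re⟩

theorem intervalIntegrable_im {f : ℝ → ℂ} {a b : ℝ} (hf : IntervalIntegrable f volume a b) :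
    IntervalIntegrable (fun t => (f t).im) volume a b :=
  ⟨hf.1.im, hf.2.im⟩

theorem re_intervalIntegral {f : ℝ → ℂ} {a b : ℝ} (hf : IntervalIntegrable f volume a b) :
    (∫ t in a..b, f t).re = ∫ t in a..b, (f t).re :=
  (Complex.reCLM.intervalIntegral_comp_comm hf).symm

theorem im_intervalIntegral {f : ℝ → ℂ} {a b : ℝ} (hf : IntervalIntegrable f volume a b) :
    (∫ t in a..b, f t).im = ∫ t in a..b, (f t).im :=
  (Complex.imCLM.intervalIntegral_comp_comm hf).symm

theorem intervalIntegrable_mul_primitive {𝕜 : Type*} [RCLike 𝕜] {f g : ℝ → 𝕜} {a b : ℝ}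
    (hf : IntervalIntegrable f volume a b) (hg : IntervalIntegrable g volume a b) :
    IntervalIntegrable (fun x => f x * (∫ t in a..x, g t) + (∫ t in a..x, f t) * g x)
      volume a b :=
  (hf.mul_continuousOn (intervalIntegral.continuousOn_primitive_interval' hg left_mem_uIcc)).add
    (hg.continuousOn_mul (intervalIntegral.continuousOn_primitive_interval' hf left_mem_uIcc))

/-- Integration by parts for two indefinite integrals, reduced to the real case by splitting into
real and imaginary parts. -/
theorem integral_primitive_mul {f g : ℝ → ℂ} {a b : ℝ} (hf : IntervalIntegrable f volume a b)
    (hg : IntervalIntegrable g volume a b) :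
    ∫ x in a..b, (f x * (∫ t in a..x, g t) + (∫ t in a..x, f t) * g x)
      = (∫ t in a..b, f t) * ∫ t in a..b, g t := by
  have hi := intervalIntegrable_mul_primitive hf hg
  have hfr := intervalIntegrable_re hf
  have hfi := intervalIntegrable_im hf
  have hgr := intervalIntegrable_re hg
  have hgi := intervalIntegrable_im hg
  have hsub : ∀ {u : ℝ → ℂ}, IntervalIntegrable u volume a b → ∀ x ∈ uIcc a b,
      IntervalIntegrable u volume a x := fun hu x hx =>
    hu.mono_set (uIcc_subset_uIcc left_mem_uIcc hx)
  apply Complex.ext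
  · rw [re_intervalIntegral hi, Complex.mul_re, re_intervalIntegral hf, re_intervalIntegral hg,
      im_intervalIntegral hf, im_intervalIntegral hg, ← integral_primitive_mul_real hfr hgr,
      ← integral_primitive_mul_real hfi hgi, ← intervalIntegral.integral_sub
        (intervalIntegrable_mul_primitive hfr hgr) (intervalIntegrable_mul_primitive hfi hgi)]
    refine intervalIntegral.integral_congr fun x hx => ?_
    simp only [Complex.add_re, Complex.mul_re, re_intervalIntegral (hsub hf x hx),
      re_intervalIntegral (hsub hg x hx), im_intervalIntegral (hsub hf x hx),
      im_intervalIntegral (hsub hg x hx)]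
    ring
  · rw [im_intervalIntegral hi, Complex.mul_im, re_intervalIntegral hf, re_intervalIntegral hg,
      im_intervalIntegral hf, im_intervalIntegral hg, ← integral_primitive_mul_real hfr hgi,
      ← integral_primitive_mul_real hfi hgr, ← intervalIntegral.integral_add
        (intervalIntegrable_mul_primitive hfr hgi) (intervalIntegrable_mul_primitive hfi hgr)]
    refine intervalIntegral.integral_congr fun x hx => ?_
    simp only [Complex.add_im, Complex.mul_im, re_intervalIntegral (hsub hf x hx),
      re_intervalIntegral (hsub hg x hx), im_intervalIntegral (hsub hf x hx),
      im_intervalIntegral (hsub hg x hx)]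
    ring

namespace HasACDeriv

variable {f f' g g' : ℝ → ℂ} {a b : ℝ}

theorem mul (hf : HasACDeriv f f' a b) (hg : HasACDeriv g g' a b) :
    HasACDeriv (fun x => f x * g x) (fun x => f' x * g x + f x * g' x) a b := by
  have hcf := hf.continuousOn
  have hcg := hg.continuousOn
  rw [← uIcc_of_le hf.le] at hcf hcg
  refine ⟨hf.le, (hf.integrable.mul_continuousOn hcg).add (hg.integrable.continuousOn_mul hcf),
    fun x hx => ?_⟩
  have hfx := hf.integrable_of_mem hx
  have hgx := hg.integrable_of_mem hx
  have key : ∫ t in a..x, (f' t * g t + f t * g' t)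
      = ∫ t in a..x, ((f' t * g a + f a * g' t)
        + (f' t * (∫ s in a..t, g' s) + (∫ s in a..t, f' s) * g' t)) := by
    refine intervalIntegral.integral_congr fun t ht => ?_
    rw [uIcc_of_le hx.1] at ht
    have ht' : t ∈ Icc a b := ⟨ht.1, ht.2.trans hx.2⟩
    simp only [hf.eq_integral t ht', hg.eq_integral t ht']
    ring
  rw [key, intervalIntegral.integral_add ((hfx.mul_const _).add (hgx.const_mul _))
    (intervalIntegrable_mul_primitive hfx hgx), intervalIntegral.integral_add (hfx.mul_const _)
    (hgx.const_mul _), integral_primitive_mul hfx hgx, intervalIntegral.integral_mul_const,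
    intervalIntegral.integral_const_mul, hf.eq_integral x hx, hg.eq_integral x hx]
  ring

theorem const_mul (c : ℂ) (hf : HasACDeriv f f' a b) :
    HasACDeriv (fun x => c * f x) (fun x => c * f' x) a b := by
  refine ⟨hf.le, hf.integrable.const_mul c, fun x hx => ?_⟩
  rw [intervalIntegral.integral_const_mul, hf.eq_integral x hx]
  ring

theorem of_hasDerivWithinAt (hab : a ≤ b)
    (hf : ∀ x ∈ Icc a b, HasDerivWithinAt f (f' x) (Icc a b) x)
    (hf' : ContinuousOn f' (Icc a b)) : HasACDeriv f f' a b := by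
  refine ⟨hab, ContinuousOn.intervalIntegrable (by rwa [uIcc_of_le hab]), fun x hx => ?_⟩
  have hsub : Icc a x ⊆ Icc a b := Icc_subset_Icc_right hx.2
  rw [intervalIntegral.integral_eq_sub_of_hasDerivAt_of_le hx.1
    (fun t ht => (hf t (hsub ht)).continuousWithinAt.mono hsub)
    (fun t ht => (hf t (hsub (Ioo_subset_Icc_self ht))).hasDerivAt
      (Icc_mem_nhds ht.1 (ht.2.trans_le hx.2)))
    (ContinuousOn.intervalIntegrable (by
      rw [uIcc_of_le hx.1]
      exact hf'.mono hsub))]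
  ring

end HasACDeriv

/-! ### Wronskians and the dependence on the spectral parameter -/

namespace IsIVPSolution

variable {Q : ℝ → ℂ} {L : ℝ} {c₀ c₁ : ℂ} {u u' : ℝ → ℂ}

theorem deriv_zero (h : IsIVPSolution Q L c₀ c₁ u u') (hL : 0 ≤ L) : u' 0 = c₁ := by
  simpa using h.deriv_eq 0 ⟨le_rfl, hL⟩

theorem hasACDeriv_deriv (h : IsIVPSolution Q L c₀ c₁ u u') (hL : 0 ≤ L) :
    HasACDeriv u' (fun x => Q x * u x) 0 L :=
  ⟨hL, h.integrable, fun x hx => by rw [h.deriv_zero hL]; exact h.deriv_eq x hx⟩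

theorem hasACDeriv (h : IsIVPSolution Q L c₀ c₁ u u') (hL : 0 ≤ L) : HasACDeriv u u' 0 L :=
  .of_hasDerivWithinAt hL h.hasDeriv (h.hasACDeriv_deriv hL).continuousOn

theorem continuousOn (h : IsIVPSolution Q L c₀ c₁ u u') : ContinuousOn u (Icc 0 L) :=
  fun x hx => (h.hasDeriv x hx).continuousWithinAt

variable {R : ℝ → ℂ} {d₀ d₁ : ℂ} {v v' : ℝ → ℂ}

/-- The Wronskian `u v' - u' v` of solutions of `u'' = Q u` and `v'' = R v` has the derivative
`(R - Q) u v`. -/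
theorem wronskian_eq (hu : IsIVPSolution Q L c₀ c₁ u u') (hv : IsIVPSolution R L d₀ d₁ v v')
    {x : ℝ} (hx : x ∈ Icc 0 L) :
    u x * v' x - u' x * v x
      = c₀ * d₁ - c₁ * d₀ + ∫ t in (0 : ℝ)..x, (R t - Q t) * (u t * v t) := by
  have hL : 0 ≤ L := hx.1.trans hx.2
  have hW := (((hu.hasACDeriv hL).mul (hv.hasACDeriv_deriv hL)).sub
    ((hu.hasACDeriv_deriv hL).mul (hv.hasACDeriv hL))).congr_deriv
      (g' := fun t => (R t - Q t) * (u t * v t)) fun t _ => by ring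
  rw [hW.eq_integral x hx, hu.init, hv.init, hu.deriv_zero hL, hv.deriv_zero hL]

end IsIVPSolution

section SpectralParameter

variable {p : ℝ → ℂ} {L : ℝ} {c₀ c₁ : ℂ} {φ φ' S S' u u' : ℂ → ℝ → ℂ}

/-- Variation of constants: two solutions with the same initial values for the spectral parameters
`l²` and `k²` differ by an integral against the fundamental system for `k²`. -/
theorem solution_sub_eq
    (hφ : ∀ k : ℂ, IsIVPSolution (fun x => p x - k ^ 2) L 1 0 (φ k) (φ' k))
    (hS : ∀ k : ℂ, IsIVPSolution (fun x => p x - k ^ 2) L 0 1 (S k) (S' k))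
    (hu : ∀ k : ℂ, IsIVPSolution (fun x => p x - k ^ 2) L c₀ c₁ (u k) (u' k))
    (k l : ℂ) {x : ℝ} (hx : x ∈ Icc 0 L) :
    u l x - u k x = (k ^ 2 - l ^ 2) * (S k x * (∫ t in (0 : ℝ)..x, φ k t * u l t)
      - φ k x * ∫ t in (0 : ℝ)..x, S k t * u l t) := by
  have hW := (hφ k).wronskian_eq (hS k) hx
  have key : ∀ m, u m x = S k x * (c₁ + (k ^ 2 - m ^ 2) * ∫ t in (0 : ℝ)..x, φ k t * u m t)
      - φ k x * (-c₀ + (k ^ 2 - m ^ 2) * ∫ t in (0 : ℝ)..x, S k t * u m t) := by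
    intro m
    have hA := (hφ k).wronskian_eq (hu m) hx
    have hB := (hS k).wronskian_eq (hu m) hx
    simp only [sub_sub_sub_cancel_left, intervalIntegral.integral_const_mul, sub_self, zero_mul,
      intervalIntegral.integral_zero, add_zero, one_mul, sub_zero, zero_sub, mul_one] at hA hB hW
    rw [← hA, ← hB]
    linear_combination (-u m x) * hW
  rw [key l, key k]
  ring

/-- The value at a fixed point of a solution with fixed initial values is an entire function of the
spectral parameter. -/
theorem differentiable_solution
    (hφ : ∀ k : ℂ, IsIVPSolution (fun x => p x - k ^ 2) L 1 0 (φ k) (φ' k))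
    (hS : ∀ k : ℂ, IsIVPSolution (fun x => p x - k ^ 2) L 0 1 (S k) (S' k))
    (hu : ∀ k : ℂ, IsIVPSolution (fun x => p x - k ^ 2) L c₀ c₁ (u k) (u' k))
    {x : ℝ} (hx : x ∈ Icc 0 L) : Differentiable ℂ fun k => u k x := by
  intro k
  have hL : 0 ≤ L := hx.1.trans hx.2
  obtain ⟨M, hM0, hMφ, hMS, hMu⟩ : ∃ M, 0 ≤ M ∧ (∀ t ∈ Icc 0 L, ‖φ k t‖ ≤ M) ∧
      (∀ t ∈ Icc 0 L, ‖S k t‖ ≤ M) ∧ ∀ t ∈ Icc 0 L, ‖u k t‖ ≤ M := by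
    obtain ⟨M₁, h₁⟩ := isCompact_Icc.exists_bound_of_continuousOn (hφ k).continuousOn
    obtain ⟨M₂, h₂⟩ := isCompact_Icc.exists_bound_of_continuousOn (hS k).continuousOn
    obtain ⟨M₃, h₃⟩ := isCompact_Icc.exists_bound_of_continuousOn (hu k).continuousOn
    exact ⟨max M₁ (max M₂ M₃), (norm_nonneg _).trans ((h₁ x hx).trans (le_max_left _ _)),
      fun t ht => (h₁ t ht).trans (le_max_left _ _),
      fun t ht => (h₂ t ht).trans ((le_max_left _ _).trans (le_max_right _ _)),
      fun t ht => (h₃ t ht).trans ((le_max_right _ _).trans (le_max_right _ _))⟩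
  -- The kernel of the variation of constants formula is bounded.
  have hker : ∀ (v : ℝ → ℂ) (m : ℝ), (∀ t ∈ Icc 0 L, ‖v t‖ ≤ m) → ∀ y ∈ Icc 0 L,
      ‖S k y * (∫ t in (0 : ℝ)..y, φ k t * v t) - φ k y * ∫ t in (0 : ℝ)..y, S k t * v t‖
        ≤ 2 * M ^ 2 * L * m := by
    intro v m hv y hy
    have hm : 0 ≤ m := (norm_nonneg _).trans (hv y hy)
    have hint : ∀ w : ℝ → ℂ, (∀ t ∈ Icc 0 L, ‖w t‖ ≤ M) →
        ‖∫ t in (0 : ℝ)..y, w t * v t‖ ≤ M * m * L := by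
      intro w hw
      refine (intervalIntegral.norm_integral_le_of_norm_le_const (C := M * m) fun t ht => ?_).trans
        ?_
      · rw [uIoc_of_le hy.1] at ht
        have ht' : t ∈ Icc 0 L := ⟨ht.1.le, ht.2.trans hy.2⟩
        rw [norm_mul]
        exact mul_le_mul (hw t ht') (hv t ht') (norm_nonneg _) hM0
      · rw [sub_zero, abs_of_nonneg hy.1]
        exact mul_le_mul_of_nonneg_left hy.2 (mul_nonneg hM0 hm)
    refine (norm_sub_le _ _).trans ?_
    rw [norm_mul, norm_mul]
    have h1 := mul_le_mul (hMS y hy) (hint _ hMφ) (norm_nonneg _) hM0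
    have h2 := mul_le_mul (hMφ y hy) (hint _ hMS) (norm_nonneg _) hM0
    linarith
  set K := 2 * M ^ 2 * L
  have hK0 : 0 ≤ K := by positivity
  have hlim : Tendsto (fun l : ℂ => ‖k ^ 2 - l ^ 2‖) (𝓝 k) (𝓝 0) := by
    have : Continuous fun l : ℂ => ‖k ^ 2 - l ^ 2‖ := by fun_prop
    simpa using this.tendsto k
  -- For `l` near `k` the maximum of `‖u l‖` is at most twice the bound for `u k`.
  have hnear : ∀ᶠ l in 𝓝 k, ∀ t ∈ Icc 0 L, ‖u l t - u k t‖ ≤ ‖k ^ 2 - l ^ 2‖ * (K * (2 * M)) := by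
    have hsmall : ∀ᶠ l in 𝓝 k, ‖k ^ 2 - l ^ 2‖ * K < 1 / 2 := by
      have := hlim.mul_const K
      rw [zero_mul] at this
      exact this.eventually_lt_const (by norm_num)
    filter_upwards [hsmall] with l hl
    obtain ⟨y, hy, hmax⟩ := isCompact_Icc.exists_isMaxOn ⟨x, hx⟩ (hu l).continuousOn.norm
    have hle : ∀ t ∈ Icc 0 L, ‖u l t - u k t‖ ≤ ‖k ^ 2 - l ^ 2‖ * (K * ‖u l y‖) := by
      intro t ht
      rw [solution_sub_eq hφ hS hu k l ht, norm_mul]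
      exact mul_le_mul_of_nonneg_left (hker _ _ (fun s hs => hmax hs) t ht) (norm_nonneg _)
    have hy2 : ‖u l y‖ ≤ 2 * M := by
      have h1 := hle y hy
      have h2 := hMu y hy
      have h3 := norm_le_norm_add_norm_sub' (u l y) (u k y)
      have h4 := mul_le_mul_of_nonneg_right hl.le (norm_nonneg (u l y))
      linarith
    intro t ht
    refine (hle t ht).trans ?_
    gcongr
  set T : ℂ → ℂ := fun l => S k x * (∫ t in (0 : ℝ)..x, φ k t * u l t)
    - φ k x * ∫ t in (0 : ℝ)..x, S k t * u l t with hT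
  have hTlim : Tendsto T (𝓝 k) (𝓝 (T k)) := by
    have hint : ∀ v : ℝ → ℂ, ContinuousOn v (Icc 0 L) → ∀ l,
        IntervalIntegrable (fun t => v t * u l t) volume 0 x := fun v hv l =>
      ContinuousOn.intervalIntegrable (by
        rw [uIcc_of_le hx.1]
        exact (hv.mul (hu l).continuousOn).mono (Icc_subset_Icc_right hx.2))
    rw [tendsto_iff_norm_sub_tendsto_zero]
    refine squeeze_zero' (Eventually.of_forall fun _ => norm_nonneg _)
      (g := fun l => K * (‖k ^ 2 - l ^ 2‖ * (K * (2 * M)))) ?_ ?_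
    · filter_upwards [hnear] with l hl
      refine le_of_eq_of_le ?_ (hker (fun t => u l t - u k t) _ hl x hx)
      simp only [hT, mul_sub]
      rw [intervalIntegral.integral_sub (hint _ (hφ k).continuousOn l)
        (hint _ (hφ k).continuousOn k), intervalIntegral.integral_sub
        (hint _ (hS k).continuousOn l) (hint _ (hS k).continuousOn k)]
      congr 1
      ring
    · simpa using (hlim.mul_const (K * (2 * M))).const_mul K
  have hderiv : HasDerivAt (fun l => u l x) (-(k + k) * T k) k := by
    rw [hasDerivAt_iff_tendsto_slope]
    have h1 : Tendsto (fun l => -(k + l) * T l) (𝓝[≠] k) (𝓝 (-(k + k) * T k)) := by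
      refine Tendsto.mul ?_ (hTlim.mono_left nhdsWithin_le_nhds)
      have : Continuous fun l : ℂ => -(k + l) := by fun_prop
      exact (this.tendsto k).mono_left nhdsWithin_le_nhds
    refine h1.congr' ?_
    filter_upwards [self_mem_nhdsWithin] with l hl
    have hlk : l - k ≠ 0 := sub_ne_zero.2 hl
    rw [slope_def_field, solution_sub_eq hφ hS hu k l hx, eq_div_iff hlk]
    ring
  exact hderiv.differentiableAt

end SpectralParameter

/-! ### The Liouville transformation -/

namespace IsRefractiveIndex

variable {n n' n'' : ℝ → ℝ}

theorem continuousOn (hn : IsRefractiveIndex n n' n'') : ContinuousOn n (Icc 0 1) :=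
  fun r hr => (hn.hasDeriv r hr).continuousWithinAt

theorem hasDerivWithinAt_liouvilleZeta (hn : IsRefractiveIndex n n' n'') {r : ℝ}
    (hr : r ∈ Icc (0 : ℝ) 1) :
    HasDerivWithinAt (liouvilleZeta n) (-√(n r)) (Icc 0 1) r := by
  have hc : ContinuousOn (fun t => √(n t)) (Icc 0 1) := hn.continuousOn.sqrt
  have : Fact (r ∈ Icc (0 : ℝ) 1) := ⟨hr⟩
  refine intervalIntegral.integral_hasDerivWithinAt_left (t := Icc 0 1) ?_
    (hc.stronglyMeasurableAtFilter_nhdsWithin measurableSet_Icc r) (hc r hr)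
  exact (hc.mono (by rw [uIcc_of_le hr.2]; exact Icc_subset_Icc_left hr.1)).intervalIntegrable

theorem continuousOn_liouvilleZeta (hn : IsRefractiveIndex n n' n'') :
    ContinuousOn (liouvilleZeta n) (Icc 0 1) :=
  fun _ hr => (hn.hasDerivWithinAt_liouvilleZeta hr).continuousWithinAt

theorem strictAntiOn_liouvilleZeta (hn : IsRefractiveIndex n n' n'') :
    StrictAntiOn (liouvilleZeta n) (Icc 0 1) :=
  strictAntiOn_of_hasDerivWithinAt_neg (convex_Icc 0 1) hn.continuousOn_liouvilleZeta
    (fun _ hr => (hn.hasDerivWithinAt_liouvilleZeta (interior_subset hr)).mono interior_subset)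
    fun r hr => neg_neg_of_pos (Real.sqrt_pos.2 (hn.pos r (interior_subset hr)))

theorem liouvilleZeta_one : liouvilleZeta n 1 = 0 := by simp [liouvilleZeta]

theorem image_liouvilleZeta (hn : IsRefractiveIndex n n' n'') {r : ℝ} (hr : r ∈ Icc (0 : ℝ) 1) :
    liouvilleZeta n '' Icc r 1 = Icc 0 (liouvilleZeta n r) := by
  have hsub : Icc r 1 ⊆ Icc (0 : ℝ) 1 := Icc_subset_Icc_left hr.1
  rw [(hn.continuousOn_liouvilleZeta.mono hsub).image_Icc_of_antitoneOn hr.2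
    (hn.strictAntiOn_liouvilleZeta.antitoneOn.mono hsub), liouvilleZeta_one]

theorem liouvilleZeta_mem (hn : IsRefractiveIndex n n' n'') {r : ℝ} (hr : r ∈ Icc (0 : ℝ) 1) :
    liouvilleZeta n r ∈ Icc 0 (travelTime n) := by
  rw [travelTime, ← hn.image_liouvilleZeta (left_mem_Icc.2 zero_le_one)]
  exact mem_image_of_mem _ hr

theorem travelTime_pos (hn : IsRefractiveIndex n n' n'') : 0 < travelTime n := by
  have := hn.strictAntiOn_liouvilleZeta (left_mem_Icc.2 zero_le_one) (right_mem_Icc.2 zero_le_one)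
    one_pos
  rwa [liouvilleZeta_one] at this

theorem liouvilleRadius_liouvilleZeta (hn : IsRefractiveIndex n n' n'') {r : ℝ}
    (hr : r ∈ Icc (0 : ℝ) 1) : liouvilleRadius n (liouvilleZeta n r) = r :=
  hn.strictAntiOn_liouvilleZeta.injOn.leftInvOn_invFunOn hr

/-- The chain rule for the Liouville variable: `G ∘ ζ` is absolutely continuous whenever `G` is. -/
theorem hasACDeriv_comp_liouvilleZeta (hn : IsRefractiveIndex n n' n'') {G g : ℝ → ℂ}
    (hG : HasACDeriv G g 0 (travelTime n)) :
    HasACDeriv (fun r => G (liouvilleZeta n r))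
      (fun r => -((√(n r) : ℝ) * g (liouvilleZeta n r))) 0 1 := by
  set h : ℝ → ℂ := fun r => (√(n r) : ℝ) * g (liouvilleZeta n r) with hh
  have habs : ∀ r, |(-√(n r))| • g (liouvilleZeta n r) = h r := fun r => by
    simp [hh, abs_of_nonneg (Real.sqrt_nonneg _)]
  have hsub : ∀ {r : ℝ}, r ∈ Icc (0 : ℝ) 1 → Icc r 1 ⊆ Icc (0 : ℝ) 1 := fun hr =>
    Icc_subset_Icc_left hr.1
  have hint : IntervalIntegrable h volume 0 1 := by
    have h1 := hG.integrable
    rw [intervalIntegrable_iff_integrableOn_Icc_of_le hn.travelTime_pos.le, travelTime,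
      ← hn.image_liouvilleZeta (left_mem_Icc.2 zero_le_one),
      integrableOn_image_iff_integrableOn_abs_deriv_smul measurableSet_Icc
        (fun r hr => hn.hasDerivWithinAt_liouvilleZeta hr) hn.strictAntiOn_liouvilleZeta.injOn]
      at h1
    simp only [habs] at h1
    rwa [intervalIntegrable_iff_integrableOn_Icc_of_le zero_le_one]
  have hval : ∀ r ∈ Icc (0 : ℝ) 1, G (liouvilleZeta n r) = G 0 + ∫ t in r..1, h t := by
    intro r hr
    have hz := hn.liouvilleZeta_mem hr
    rw [hG.eq_integral _ hz, intervalIntegral.integral_of_le hz.1, ← integral_Icc_eq_integral_Ioc,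
      ← hn.image_liouvilleZeta hr, integral_image_eq_integral_abs_deriv_smul measurableSet_Icc
        (fun t ht => (hn.hasDerivWithinAt_liouvilleZeta (hsub hr ht)).mono (hsub hr))
        (hn.strictAntiOn_liouvilleZeta.injOn.mono (hsub hr)),
      intervalIntegral.integral_of_le hr.2, ← integral_Icc_eq_integral_Ioc]
    simp only [habs]
  refine ⟨zero_le_one, hint.neg, fun r hr => ?_⟩
  have h0r : IntervalIntegrable h volume 0 r :=
    hint.mono_set (uIcc_subset_uIcc left_mem_uIcc (by rwa [uIcc_of_le zero_le_one]))
  have hr1 : IntervalIntegrable h volume r 1 :=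
    hint.mono_set (uIcc_subset_uIcc (by rwa [uIcc_of_le zero_le_one]) right_mem_uIcc)
  rw [hval r hr, hval 0 (left_mem_Icc.2 zero_le_one), intervalIntegral.integral_neg,
    ← intervalIntegral.integral_add_adjacent_intervals h0r hr1]
  ring

theorem hasACDeriv_deriv (hn : IsRefractiveIndex n n' n'') :
    HasACDeriv (fun r => (n' r : ℂ)) (fun r => (n'' r : ℂ)) 0 1 := by
  have hi : IntervalIntegrable n'' volume 0 1 := by
    rw [intervalIntegrable_iff_integrableOn_Ioo_of_le zero_le_one]
    exact hn.memLp.integrable one_le_two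
  refine ⟨zero_le_one, ⟨hi.1.ofReal, hi.2.ofReal⟩, fun r hr => ?_⟩
  rw [hn.deriv_eq r hr, intervalIntegral.integral_ofReal]
  push_cast
  rfl

theorem rpow_quarter_pow_four (hn : IsRefractiveIndex n n' n'') {r : ℝ} (hr : r ∈ Icc (0 : ℝ) 1) :
    (n r ^ (1 / 4 : ℝ)) ^ 4 = n r := by
  rw [← Real.rpow_natCast, ← Real.rpow_mul (hn.pos r hr).le]
  norm_num

theorem rpow_quarter_sq (hn : IsRefractiveIndex n n' n'') {r : ℝ} (hr : r ∈ Icc (0 : ℝ) 1) :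
    (n r ^ (1 / 4 : ℝ)) ^ 2 = √(n r) := by
  rw [Real.sqrt_eq_rpow, ← Real.rpow_natCast, ← Real.rpow_mul (hn.pos r hr).le]
  norm_num

theorem rpow_five_quarters (hn : IsRefractiveIndex n n' n'') {r : ℝ} (hr : r ∈ Icc (0 : ℝ) 1) :
    n r ^ (5 / 4 : ℝ) = (n r ^ (1 / 4 : ℝ)) ^ 5 := by
  rw [← Real.rpow_natCast, ← Real.rpow_mul (hn.pos r hr).le]
  norm_num

theorem hasDerivWithinAt_rpow_quarter (hn : IsRefractiveIndex n n' n'') {r : ℝ}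
    (hr : r ∈ Icc (0 : ℝ) 1) : HasDerivWithinAt (fun r => n r ^ (1 / 4 : ℝ))
      (n' r / 4 * (n r ^ (1 / 4 : ℝ))⁻¹ ^ 3) (Icc 0 1) r := by
  have hpos := hn.pos r hr
  convert (hn.hasDeriv r hr).rpow_const (p := 1 / 4) (Or.inl hpos.ne') using 1
  rw [← Real.rpow_neg hpos.le, ← Real.rpow_natCast, ← Real.rpow_mul hpos.le]
  norm_num
  left
  ring

theorem hasACDeriv_rpow_quarter (hn : IsRefractiveIndex n n' n'') :
    HasACDeriv (fun r => ((n r ^ (1 / 4 : ℝ) : ℝ) : ℂ))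
      (fun r => ((n' r / 4 * (n r ^ (1 / 4 : ℝ))⁻¹ ^ 3 : ℝ) : ℂ)) 0 1 := by
  refine .of_hasDerivWithinAt zero_le_one
    (fun r hr => (hn.hasDerivWithinAt_rpow_quarter hr).ofReal_comp) ?_
  have h1 := hn.hasACDeriv_deriv.continuousOn
  have h2 : ContinuousOn (fun r => n r ^ (1 / 4 : ℝ)) (Icc 0 1) := fun r hr =>
    (hn.hasDerivWithinAt_rpow_quarter hr).continuousWithinAt
  have h3 := Complex.continuous_ofReal.comp_continuousOn
    ((h2.inv₀ fun r hr => (Real.rpow_pos_of_pos (hn.pos r hr) _).ne').pow 3)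
  refine ((h1.div_const 4).mul h3).congr fun r _ => ?_
  simp

theorem hasACDeriv_rpow_quarter_inv (hn : IsRefractiveIndex n n' n'') :
    HasACDeriv (fun r => (((n r ^ (1 / 4 : ℝ))⁻¹ : ℝ) : ℂ))
      (fun r => ((-(n' r / 4 * (n r ^ (1 / 4 : ℝ))⁻¹ ^ 5) : ℝ) : ℂ)) 0 1 := by
  have hm : ∀ r ∈ Icc (0 : ℝ) 1, n r ^ (1 / 4 : ℝ) ≠ 0 := fun r hr =>
    (Real.rpow_pos_of_pos (hn.pos r hr) _).ne'
  refine .of_hasDerivWithinAt zero_le_one (fun r hr => ?_) ?_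
  · have := ((hn.hasDerivWithinAt_rpow_quarter hr).fun_inv (hm r hr)).ofReal_comp
    convert this using 2
    have := hm r hr
    field_simp
  · have h1 := hn.hasACDeriv_deriv.continuousOn
    have h2 : ContinuousOn (fun r => n r ^ (1 / 4 : ℝ)) (Icc 0 1) := fun r hr =>
      (hn.hasDerivWithinAt_rpow_quarter hr).continuousWithinAt
    have h3 := Complex.continuous_ofReal.comp_continuousOn ((h2.inv₀ hm).pow 5)
    refine ((h1.div_const 4).mul h3).neg.congr fun r _ => ?_
    simp

/-- The Liouville transformation. If `-u'' + p u = k² u` on `[0,δ]`, and `y'' + k² n y = 0` with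
`y(0) = 0`, `y'(0) = 1`, then the Wronskian of `u` and `n^{1/4} y` with respect to the variable `ζ`
is constant; its values at `ζ = 0` and `ζ = δ` give `u(δ)` in terms of `y(1)` and `y'(1)`. -/
theorem solution_travelTime_eq (hn : IsRefractiveIndex n n' n'') {k c₀ c₁ : ℂ}
    {y y' u u' : ℝ → ℂ} (hy : IsIVPSolution (fun r => -(k ^ 2 * (n r : ℂ))) 1 0 1 y y')
    (hu : IsIVPSolution (fun x => (liouvillePotential n n' n'' x : ℂ) - k ^ 2)
      (travelTime n) c₀ c₁ u u') :
    u (travelTime n) = ((n 0 ^ (1 / 4 : ℝ) : ℝ) : ℂ) *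
      (c₀ * (((n' 1 / (4 * n 1 ^ (5 / 4 : ℝ)) : ℝ) : ℂ) * y 1
        + y' 1 / ((n 1 ^ (1 / 4 : ℝ) : ℝ) : ℂ)) + c₁ * (((n 1 ^ (1 / 4 : ℝ) : ℝ) : ℂ) * y 1)) := by
  have hδ := hn.travelTime_pos.le
  have hU := hn.hasACDeriv_comp_liouvilleZeta (hu.hasACDeriv hδ)
  have hV := hn.hasACDeriv_comp_liouvilleZeta (hu.hasACDeriv_deriv hδ)
  have hm := hn.hasACDeriv_rpow_quarter
  have hμ := hn.hasACDeriv_rpow_quarter_inv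
  have hy1 := hy.hasACDeriv zero_le_one
  have hy2 := hy.hasACDeriv_deriv zero_le_one
  -- With `m = n^{1/4}`, the coefficient of `y` in the derivative of `m y` by `-ζ` is `n' / (4 m⁵)`.
  have hα := (hn.hasACDeriv_deriv.const_mul (1 / 4)).mul
    (((hμ.mul hμ).mul (hμ.mul hμ)).mul hμ)
  have hW := ((hU.mul ((hα.mul hy1).add (hμ.mul hy2))).add (hV.mul (hm.mul hy1))).congr_deriv
    (g' := fun _ => 0) fun r hr => by
      have hM : ((n r ^ (1 / 4 : ℝ) : ℝ) : ℂ) ≠ 0 :=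
        Complex.ofReal_ne_zero.2 (Real.rpow_pos_of_pos (hn.pos r hr) _).ne'
      simp only [liouvillePotential, hn.liouvilleRadius_liouvilleZeta hr,
        ← hn.rpow_quarter_sq hr]
      generalize hMdef : n r ^ (1 / 4 : ℝ) = M at hM
      have hnM : n r = M ^ 4 := by rw [← hMdef, hn.rpow_quarter_pow_four hr]
      rw [hnM]
      push_cast
      field_simp
      ring
  have hend := hW.eq_integral 1 (right_mem_Icc.2 zero_le_one)
  have h0 : liouvilleZeta n 0 = travelTime n := rfl
  have hM₁ : ((n 1 ^ (1 / 4 : ℝ) : ℝ) : ℂ) ≠ 0 := Complex.ofReal_ne_zero.2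
    (Real.rpow_pos_of_pos (hn.pos 1 (right_mem_Icc.2 zero_le_one)) _).ne'
  have hM₀ : ((n 0 ^ (1 / 4 : ℝ) : ℝ) : ℂ) ≠ 0 := Complex.ofReal_ne_zero.2
    (Real.rpow_pos_of_pos (hn.pos 0 (left_mem_Icc.2 zero_le_one)) _).ne'
  simp only [liouvilleZeta_one, h0, hu.init, hu.deriv_zero hδ, hy.init,
    hy.deriv_zero zero_le_one, intervalIntegral.integral_zero, mul_zero, mul_one, add_zero,
    zero_add, Complex.ofReal_inv] at hend
  rw [eq_mul_inv_iff_mul_eq₀ hM₀] at hend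
  rw [← hend, hn.rpow_five_quarters (right_mem_Icc.2 zero_le_one)]
  push_cast
  field_simp

/-- Up to the factor `n(0)^{1/4}` the two characteristic functions agree. -/
theorem charFunD_eq (hn : IsRefractiveIndex n n' n'') {y y' φ φ' S S' : ℂ → ℝ → ℂ}
    (hy : ∀ k : ℂ, IsIVPSolution (fun r => -(k ^ 2 * (n r : ℂ))) 1 0 1 (y k) (y' k))
    (hφ : ∀ k : ℂ, IsIVPSolution (fun x => (liouvillePotential n n' n'' x : ℂ) - k ^ 2)
      (travelTime n) 1 0 (φ k) (φ' k))
    (hS : ∀ k : ℂ, IsIVPSolution (fun x => (liouvillePotential n n' n'' x : ℂ) - k ^ 2)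
      (travelTime n) 0 1 (S k) (S' k)) (k : ℂ) :
    charFunD n n' φ S k = ((n 0 ^ (1 / 4 : ℝ) : ℝ) : ℂ) * charFunY y y' k := by
  have hM₁ : ((n 1 ^ (1 / 4 : ℝ) : ℝ) : ℂ) ≠ 0 := Complex.ofReal_ne_zero.2
    (Real.rpow_pos_of_pos (hn.pos 1 (right_mem_Icc.2 zero_le_one)) _).ne'
  rw [charFunD, coeffA, coeffB, charFunY, hn.solution_travelTime_eq (hy k) (hφ k),
    hn.solution_travelTime_eq (hy k) (hS k)]
  field_simp
  ring

end IsRefractiveIndex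

/-! ### The characteristic functions are entire -/

theorem differentiable_divVar {f : ℂ → ℂ} (hf : Differentiable ℂ f) (h0 : f 0 = 0) :
    Differentiable ℂ (divVar f) := by
  have : divVar f = dslope f 0 := by
    ext k
    by_cases hk : k = 0
    · simp [divVar, hk]
    · simp [divVar, hk, dslope_of_ne, slope_def_field, h0]
  rw [this]
  exact differentiable_dslope hf 0

theorem sphericalBesselJ_odd_zero (m : ℕ) : sphericalBesselJ (2 * m + 1) 0 = 0 := by
  simp [sphericalBesselJ]

theorem differentiable_coeffA (n : ℝ → ℝ) : Differentiable ℂ (coeffA n) :=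
  (differentiable_divVar Complex.differentiable_sin Complex.sin_zero).const_mul _

theorem differentiable_coeffB (n n' : ℝ → ℝ) : Differentiable ℂ (coeffB n n') :=
  ((Complex.differentiable_cos.div_const _).add
    ((differentiable_divVar Complex.differentiable_sin Complex.sin_zero).const_mul _)).neg

theorem differentiable_charFunDTrunc (n n' : ℝ → ℝ) (φ S : ℂ → ℝ → ℂ) (N : ℕ) :
    Differentiable ℂ (charFunDTrunc n n' φ S N) := by
  have hj := sphericalBesselJ_differentiable
  have hφ : Differentiable ℂ fun k => phiTrunc φ N k (travelTime n) := by
    unfold phiTrunc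
    fun_prop
  have hS : Differentiable ℂ fun k => sTrunc S N k (travelTime n) := by
    unfold sTrunc
    refine (differentiable_divVar (by fun_prop) (by simp)).add
      (differentiable_divVar (by fun_prop) ?_)
    simp [sphericalBesselJ_odd_zero]
  exact ((differentiable_coeffA n).mul hφ).add ((differentiable_coeffB n n').mul hS)

theorem proposition4p1
    (n n' n'' : ℝ → ℝ) (hn : IsRefractiveIndex n n' n'')
    -- the solution of `y'' + k² n y = 0` on `[0,1]` with `y(0) = 0`, `y'(0) = 1`
    (y y' : ℂ → ℝ → ℂ)
    (hy : ∀ k : ℂ, IsIVPSolution (fun r => -(k ^ 2 * (n r : ℂ))) 1 0 1 (y k) (y' k))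
    -- the fundamental solutions of `-z'' + p z = k² z` on `[0,δ]`
    (φ φ' S S' : ℂ → ℝ → ℂ)
    (hφ : ∀ k : ℂ, IsIVPSolution (fun x => (liouvillePotential n n' n'' x : ℂ) - k ^ 2)
      (travelTime n) 1 0 (φ k) (φ' k))
    (hS : ∀ k : ℂ, IsIVPSolution (fun x => (liouvillePotential n n' n'' x : ℂ) - k ^ 2)
      (travelTime n) 0 1 (S k) (S' k))
    (N : ℕ) (ε C : ℝ)
    (happrox : ∀ k : ℂ, |k.im| < C → ‖charFunD n n' φ S k - charFunDTrunc n n' φ S N k‖ < ε)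
    (γ : ℝ → ℂ) (hγ : IsSimpleClosedCurve γ)
    (hstrip : ∀ k ∈ γ '' Icc 0 1, |k.im| < C)
    (hmin : ∀ k ∈ γ '' Icc 0 1, ε < ‖charFunDTrunc n n' φ S N k‖) :
    ∃ m : ℕ, HasZeroCount (charFunD n n' φ S) (insideOf (γ '' Icc 0 1)) m ∧
      HasZeroCount (charFunDTrunc n n' φ S N) (insideOf (γ '' Icc 0 1)) m ∧
      HasZeroCount (charFunY y y') (insideOf (γ '' Icc 0 1)) m := by
  have hδ : travelTime n ∈ Icc 0 (travelTime n) := right_mem_Icc.2 hn.travelTime_pos.le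
  have hD : Differentiable ℂ (charFunD n n' φ S) :=
    ((differentiable_coeffA n).mul (differentiable_solution hφ hS hφ hδ)).add
      ((differentiable_coeffB n n').mul (differentiable_solution hφ hS hS hδ))
  obtain ⟨m, h1, h2⟩ := exists_hasZeroCount_insideOf hD (differentiable_charFunDTrunc n n' φ S N)
    (isCompact_Icc.image_of_continuousOn hγ.cont) ((nonempty_Icc.2 zero_le_one).image γ)
    fun k hk => (happrox k (hstrip k hk)).trans (hmin k hk)
  refine ⟨m, h1, h2, ?_⟩
  have hM₀ : ((n 0 ^ (1 / 4 : ℝ) : ℝ) : ℂ) ≠ 0 := Complex.ofReal_ne_zero.2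
    (Real.rpow_pos_of_pos (hn.pos 0 (left_mem_Icc.2 zero_le_one)) _).ne'
  have hY : charFunY y y'
      = fun k => ((n 0 ^ (1 / 4 : ℝ) : ℝ) : ℂ)⁻¹ * charFunD n n' φ S k := by
    ext k
    rw [hn.charFunD_eq hy hφ hS, inv_mul_cancel_left₀ hM₀]
  rw [hY]
  exact h1.const_mul (inv_ne_zero hM₀)
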